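/- All graphs are finite and simple. A total-$k$-coloring of a graph assigns one of $k$ colors to each vertex and each edge so that adjacent vertices, distinct edges sharing an endpoint, and an edge and either of its endpoints always receive different colors. Let $G$ be a planar graph with maximum degree $\Delta$, and let $H$ be a subgraph of $G$ that is a matching, i.e. $H$ consists of vertex-disjoint copies of $K_2$. Let $\varphi$ be a total-$(\Delta+7)$-coloring of $H$ in $G$, that is, a total-$(\Delta+7)$-coloring of $H$ such that any two vertices of $H$ that are adjacent in $G$ receive different colors. Then $\varphi$ extends to $G$: there is a total-$(\Delta+7)$-coloring of $G$ that agrees with $\varphi$ on all vertices and edges of $H$. -/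

import Mathlib

namespace SimpleGraph

/-- The Euclidean plane. -/
abbrev Plane : Type := EuclideanSpace ℝ (Fin 2)

/-- `A` is a simple polygonal arc from `a` to `b`: it is the union of `n` nondegenerate straight
segments `[p i, p (i + 1)]`, `i < n`, with `p 0 = a` and `p n = b`, where consecutive segments meet
only in their common end and other pairs of segments are disjoint. -/
def IsPolygonalArc (a b : Plane) (A : Set Plane) : Prop :=
  ∃ (n : ℕ) (p : ℕ → Plane),
    p 0 = a ∧ p n = b ∧
    A = {x | ∃ i < n, x ∈ segment ℝ (p i) (p (i + 1))} ∧
    (∀ i < n, p i ≠ p (i + 1)) ∧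
    (∀ i j, i < j → j < n →
      ∀ x ∈ segment ℝ (p i) (p (i + 1)), x ∈ segment ℝ (p j) (p (j + 1)) →
        j = i + 1 ∧ x = p j)

/-- A drawing of `G` in the plane without crossings. The values of `arc` at pairs that are not
edges of `G` play no role. -/
structure PlaneDrawing {V : Type*} (G : SimpleGraph V) where
  /-- the point that represents a vertex -/
  pos : V → Plane
  /-- the arc that represents an edge -/
  arc : Sym2 V → Set Plane
  pos_injective : Function.Injective pos
  isPolygonalArc : ∀ u v, G.Adj u v → IsPolygonalArc (pos u) (pos v) (arc s(u, v))
  /-- an edge passes through no vertices other than its ends -/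
  mem_of_pos_mem_arc : ∀ e ∈ G.edgeSet, ∀ w, pos w ∈ arc e → w ∈ e
  /-- two edges meet only in a common end -/
  no_crossing : ∀ e ∈ G.edgeSet, ∀ f ∈ G.edgeSet, e ≠ f →
    ∀ x ∈ arc e, x ∈ arc f → ∃ w, w ∈ e ∧ w ∈ f ∧ x = pos w

/-- A graph is planar if it can be drawn in the plane without crossings. -/
def IsPlanar {V : Type*} (G : SimpleGraph V) : Prop :=
  Nonempty G.PlaneDrawing

/-- A total-`k`-coloring of `G`: the vertices and the edges of `G` receive colors from a set of `k`
colors, so that adjacent vertices, distinct edges with a common end, and an edge and either of its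
ends, receive different colors. -/
structure TotalColoring {V : Type*} (G : SimpleGraph V) (k : ℕ) where
  /-- the color of a vertex -/
  vert : V → Fin k
  /-- the color of an edge -/
  edge : G.edgeSet → Fin k
  vert_ne : ∀ u v, G.Adj u v → vert u ≠ vert v
  edge_ne : ∀ e f : G.edgeSet, e ≠ f → ∀ v, v ∈ e.1 → v ∈ f.1 → edge e ≠ edge f
  vert_ne_edge : ∀ (v : V) (e : G.edgeSet), v ∈ e.1 → vert v ≠ edge e

namespace TotalColoring

variable {V : Type*} {G : SimpleGraph V} {H : G.Subgraph} {k : ℕ}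

/-- The total coloring `φ` of the subgraph `H` is a total coloring of `H` in `G`: it is proper also
with respect to `G`, that is, vertices of `H` that are adjacent in `G` receive different colors.
(For the other two kinds of conflicts, being proper in `H` and in `G` is the same.) -/
def IsIn (φ : H.coe.TotalColoring k) : Prop :=
  ∀ u v : H.verts, G.Adj u v → φ.vert u ≠ φ.vert v

/-- The total coloring `ψ` of `G` agrees with `φ` on all vertices and edges of `H`. -/
def Extends (ψ : G.TotalColoring k) (φ : H.coe.TotalColoring k) : Prop :=
  (∀ v : H.verts, ψ.vert v = φ.vert v) ∧
    ∀ e : H.coe.edgeSet, ψ.edge (H.hom.mapEdgeSet e) = φ.edge e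

end TotalColoring

end SimpleGraph

/-! Color greedily, vertices before edges. There are more than Δ colors, so the vertex colors on `H`
extend to all vertices. For the edges, every nonempty set F of uncolored edges has a vertex u of
degree between 1 and 5 in F. Set aside an edge uv of F, color the rest of F recursively, then color
uv: it sees at most 4 edges of F and one matching edge at u, at most Δ - 1 edges at v, and two
vertex colors, at most Δ + 6 colors in all.

The vertex u comes from the bound |E| ≤ 3|U| - 3, a weak form of the consequence of Euler's formula.
By `IsPlanar.exists_two_basis`, face boundaries span the cycle space and cover each edge at most
twice. A nonzero cycle has at least 3 edges, so the dimension is at most 2|E|/3, whereas |E| < dim +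
|U|.

Faces are obtained by a sweep, without the Jordan curve theorem. The drawing is a system of
segments, sheared so that none is vertical and cut by vertical lines through their ends. Between two
consecutive lines the strands are linearly ordered, and a region is labelled by the function that
sends a cycle z to the parity of z on the strands above. Crossing a strand s changes the label by
z(s). The strands with exactly one side labelled γ form an element of the cycle space, and weighting
these by γ(z) and summing over γ returns z. -/

open Finset

/-! ### Face boundaries in a system of strands -/

/-- Telescoping over the level set `ht = y` of a finite chain ordered by `key`. -/
theorem sum_levelSet_telescope {α : Type*} [DecidableEq α] (A : Finset α) (key ht : α → ℝ)
    (hmono : ∀ s ∈ A, ∀ c ∈ A, key s < key c → ht s ≤ ht c)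
    (hinj : Set.InjOn key A) (g : Finset α → ZMod 2) (y : ℝ) :
    ∑ s ∈ A with ht s = y, (g {c ∈ A | key s < key c} + g (insert s {c ∈ A | key s < key c})) =
      g {c ∈ A | y < ht c} + g {c ∈ A | y ≤ ht c} := by
  set U : Finset α := {c ∈ A | y < ht c} with hU
  have key_lt : ∀ u ∈ U, ∀ t ∈ A, ht t = y → key t < key u := by
    intro u hu t ht' hty
    rw [hU, mem_filter] at hu
    by_contra! h
    rcases h.lt_or_eq with h | h
    · linarith [hmono u hu.1 t ht' h]
    · rw [hinj hu.1 ht' h] at hu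
      linarith
  -- Add elements from the top down: a new lowest element changes no earlier term, since those look
  -- upwards only, and its own term cancels the last value of `g`.
  have main : ∀ T : Finset α, T ⊆ {s ∈ A | ht s = y} →
      ∑ s ∈ T, (g {c ∈ U ∪ T | key s < key c} + g (insert s {c ∈ U ∪ T | key s < key c})) =
        g U + g (U ∪ T) := by
    intro T
    induction T using Finset.induction_on_min_value key with
    | empty => intro _; simp [CharTwo.add_self_eq_zero]
    | insert a T ha hmin ih =>
      intro hT
      have hTA : ∀ x ∈ insert a T, x ∈ A ∧ ht x = y := fun x hx => by simpa using hT hx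
      have hlt : ∀ x ∈ T, key a < key x := fun x hx =>
        lt_of_le_of_ne (hmin x hx) fun h => ha <| by
          rwa [hinj (hTA a (by simp)).1 (hTA x (by simp [hx])).1 h]
      rw [sum_insert ha]
      have h1 : ({c ∈ U ∪ insert a T | key a < key c} : Finset α) = U ∪ T := by
        ext c
        simp only [mem_filter, mem_union, mem_insert]
        constructor
        · rintro ⟨h | rfl | h, h'⟩
          · exact Or.inl h
          · exact absurd h' (lt_irrefl _)
          · exact Or.inr h
        · rintro (h | h)
          · exact ⟨Or.inl h, key_lt c h a (hTA a (by simp)).1 (hTA a (by simp)).2⟩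
          · exact ⟨Or.inr (Or.inr h), hlt c h⟩
      have h2 : ∀ s ∈ T, ({c ∈ U ∪ insert a T | key s < key c} : Finset α) =
          {c ∈ U ∪ T | key s < key c} := by
        intro s hs
        ext c
        simp only [mem_filter, mem_union, mem_insert]
        constructor
        · rintro ⟨h | rfl | h, h'⟩
          · exact ⟨Or.inl h, h'⟩
          · exact absurd h' (hlt s hs).not_gt
          · exact ⟨Or.inr h, h'⟩
        · rintro ⟨h | h, h'⟩
          · exact ⟨Or.inl h, h'⟩
          · exact ⟨Or.inr (Or.inr h), h'⟩
      have h3 : insert a (U ∪ T) = U ∪ insert a T := by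
        ext c; simp only [mem_union, mem_insert]; tauto
      rw [sum_congr rfl fun s hs => by rw [h2 s hs],
        ih fun x hx => hT (mem_insert_of_mem hx), h1, h3]
      calc _ = (g (U ∪ T) + g (U ∪ T)) + (g U + g (U ∪ insert a T)) := by ring
        _ = _ := by rw [CharTwo.add_self_eq_zero, zero_add]
  have hUT : ({c ∈ A | y ≤ ht c} : Finset α) = U ∪ {s ∈ A | ht s = y} := by
    ext c
    simp only [hU, mem_filter, mem_union]
    constructor
    · rintro ⟨h, h'⟩
      rcases h'.lt_or_eq with h' | h'
      · exact Or.inl ⟨h, h'⟩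
      · exact Or.inr ⟨h, h'.symm⟩
    · rintro (⟨h, h'⟩ | ⟨h, h'⟩)
      · exact ⟨h, h'.le⟩
      · exact ⟨h, h'.ge⟩
  rw [hUT, ← main _ subset_rfl]
  refine sum_congr rfl fun s hs => ?_
  have : ({c ∈ A | key s < key c} : Finset α) =
      {c ∈ U ∪ {s ∈ A | ht s = y} | key s < key c} := by
    rw [← hUT]
    ext c
    simp only [mem_filter] at hs ⊢
    constructor
    · rintro ⟨h, h'⟩
      exact ⟨⟨h, hs.2 ▸ hmono s hs.1 c h h'⟩, h'⟩
    · rintro ⟨⟨h, _⟩, h'⟩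
      exact ⟨h, h'⟩
  rw [this]

/-- A system of strands in the plane, recorded by their heights on the vertical lines
`0, 1, 2, …`: the strand `s` runs from the line `lo s` to the line `hi s`, no two strands cross
between consecutive lines, and they meet on a line only where both of them end. -/
structure StrandSystem (S : Type*) where
  /-- the line on which a strand begins -/
  lo : S → ℕ
  /-- the line on which a strand ends -/
  hi : S → ℕ
  /-- the height of a strand on a line -/
  height : S → ℕ → ℝ
  lo_lt_hi : ∀ s, lo s < hi s
  ordered : ∀ s c k, s ≠ c → lo s ≤ k → k < hi s → lo c ≤ k → k < hi c →
    (height s k ≤ height c k ∧ height s (k + 1) ≤ height c (k + 1) ∧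
      height s k + height s (k + 1) < height c k + height c (k + 1)) ∨
    (height c k ≤ height s k ∧ height c (k + 1) ≤ height s (k + 1) ∧
      height c k + height c (k + 1) < height s k + height s (k + 1))
  meet : ∀ s c k, s ≠ c → lo s ≤ k → k ≤ hi s → lo c ≤ k → k ≤ hi c →
    height s k = height c k → lo s = k ∨ hi s = k

namespace StrandSystem

variable {S : Type*} [Fintype S] (A : StrandSystem S)

/-- The sets of strands, as functions to `ZMod 2`, with an even number of ends at each point. -/
def cycleSpace : Submodule (ZMod 2) (S → ZMod 2) where
  carrier := {z | ∀ k y, ∑ s with (A.lo s = k ∨ A.hi s = k) ∧ A.height s k = y, z s = 0}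
  zero_mem' := by intro k y; simp
  add_mem' := by
    intro a b ha hb k y
    simp only [Pi.add_apply, sum_add_distrib, ha k y, hb k y, add_zero]
  smul_mem' := by
    intro r a ha k y
    simp only [Pi.smul_apply, ← smul_sum, ha k y, smul_zero]

/-- The strands between the lines `k` and `k + 1`. -/
def slab (k : ℕ) : Finset S := {s | A.lo s ≤ k ∧ k < A.hi s}

/-- A number that orders the strands between the lines `k` and `k + 1` from bottom to top. -/
noncomputable def key (k : ℕ) (s : S) : ℝ := A.height s k + A.height s (k + 1)

/-- The strands above `s` between the lines `k` and `k + 1`. -/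
noncomputable def above (k : ℕ) (s : S) : Finset S := {c ∈ A.slab k | A.key k s < A.key k c}

/-- The parity of the elements of the cycle space on a set of strands. -/
def parity (T : Finset S) : A.cycleSpace → ZMod 2 := fun z => ∑ c ∈ T, z.1 c

theorem mem_slab {k : ℕ} {s : S} : s ∈ A.slab k ↔ A.lo s ≤ k ∧ k < A.hi s := by simp [slab]

/-- Strands with a common end tie on one line; the strict inequality between sums in `ordered` still
separates them. -/
theorem key_injOn (k : ℕ) : Set.InjOn (A.key k) (A.slab k) := by
  intro s hs c hc h
  rw [mem_coe, mem_slab] at hs hc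
  by_contra hne
  unfold key at h
  rcases A.ordered s c k hne hs.1 hs.2 hc.1 hc.2 with h' | h' <;> linarith [h'.2.2]

theorem height_le_of_key_lt {k : ℕ} {s c : S} (hs : s ∈ A.slab k) (hc : c ∈ A.slab k)
    (h : A.key k s < A.key k c) :
    A.height s k ≤ A.height c k ∧ A.height s (k + 1) ≤ A.height c (k + 1) := by
  rw [mem_slab] at hs hc
  have hne : s ≠ c := by rintro rfl; exact lt_irrefl _ h
  unfold key at h
  rcases A.ordered s c k hne hs.1 hs.2 hc.1 hc.2 with h' | h'
  · exact ⟨h'.1, h'.2.1⟩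
  · linarith [h'.2.2]

theorem notMem_above (k : ℕ) (s : S) : s ∉ A.above k s := by simp [above]

theorem parity_insert_above [DecidableEq S] (k : ℕ) (s : S) :
    A.parity (insert s (A.above k s)) = fun z => z.1 s + A.parity (A.above k s) z := by
  funext z
  rw [parity, sum_insert (A.notMem_above k s), parity]

theorem sum_ends_eq_zero (z : A.cycleSpace) (k : ℕ) (P : ℝ → Prop) [DecidablePred P] :
    ∑ s with (A.lo s = k ∨ A.hi s = k) ∧ P (A.height s k), z.1 s = 0 := by
  rw [← sum_fiberwise_of_maps_to (t := univ.image fun s => A.height s k)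
    (g := fun s => A.height s k) (fun s _ => mem_image_of_mem _ (mem_univ s))]
  refine sum_eq_zero fun y _ => ?_
  rw [filter_filter]
  by_cases hP : P y
  · rw [← z.2 k y]
    refine sum_congr (filter_congr fun s _ => ?_) fun _ _ => rfl
    constructor
    · rintro ⟨⟨h, _⟩, h'⟩; exact ⟨h, h'⟩
    · rintro ⟨h, h'⟩; exact ⟨⟨h, h' ▸ hP⟩, h'⟩
  · rw [filter_false_of_mem, sum_empty]
    rintro s _ ⟨⟨_, h⟩, h'⟩
    exact hP (h' ▸ h)

/-- Passing a line does not change the parity of an up-set of strands. -/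
theorem parity_slab_succ (k : ℕ) (P : ℝ → Prop) [DecidablePred P] :
    A.parity {s ∈ A.slab k | P (A.height s (k + 1))} =
      A.parity {s ∈ A.slab (k + 1) | P (A.height s (k + 1))} := by
  classical
  funext z
  have h := A.sum_ends_eq_zero z (k + 1) P
  rw [← CharTwo.add_eq_zero, ← h]
  simp only [parity, slab, filter_filter, sum_filter]
  rw [← sum_add_distrib]
  refine sum_congr rfl fun s _ => ?_
  have := A.lo_lt_hi s
  by_cases hP : P (A.height s (k + 1))
  · simp only [hP, and_true]
    by_cases h1 : A.lo s = k + 1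
    · rw [if_neg (by lia), if_pos (by lia), if_pos (by lia), zero_add]
    · by_cases h2 : A.hi s = k + 1
      · rw [if_pos (by lia), if_neg (by lia), if_pos (by lia), add_zero]
      · by_cases h3 : A.lo s ≤ k ∧ k < A.hi s
        · rw [if_pos (by lia), if_pos (by lia), if_neg (by lia), CharTwo.add_self_eq_zero]
        · rw [if_neg (by lia), if_neg (by lia), if_neg (by lia), add_zero]
  · simp [hP]

/-- A strand that continues past a line meets no other strand there, so on both sides of the line
"above" is decided by the heights on it, and `parity_slab_succ` applies. -/
theorem parity_above_succ {k : ℕ} {s : S} (hs : A.lo s ≤ k) (hs' : k + 1 < A.hi s) :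
    A.parity (A.above k s) = A.parity (A.above (k + 1) s) := by
  have hne : ∀ c, c ≠ s → A.lo c ≤ k + 1 → k + 1 ≤ A.hi c →
      A.height s (k + 1) ≠ A.height c (k + 1) := by
    intro c hc h1 h2 h
    have := A.meet s c (k + 1) hc.symm (by lia) (by lia) h1 h2 h
    lia
  have h1 : A.above k s = {c ∈ A.slab k | A.height s (k + 1) < A.height c (k + 1)} := by
    refine filter_congr fun c hc => ?_
    have hsk : s ∈ A.slab k := A.mem_slab.2 ⟨hs, by lia⟩
    constructor
    · intro h
      refine lt_of_le_of_ne (A.height_le_of_key_lt hsk hc h).2 (hne c ?_ ?_ ?_)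
      · rintro rfl; exact lt_irrefl _ h
      all_goals rw [mem_slab] at hc; lia
    · intro h
      by_contra! h'
      rcases h'.lt_or_eq with h' | h'
      · linarith [(A.height_le_of_key_lt hc hsk h').2]
      · rw [A.key_injOn k hc hsk h'] at h
        exact lt_irrefl _ h
  have h2 : A.above (k + 1) s =
      {c ∈ A.slab (k + 1) | A.height s (k + 1) < A.height c (k + 1)} := by
    refine filter_congr fun c hc => ?_
    have hsk : s ∈ A.slab (k + 1) := A.mem_slab.2 ⟨by lia, by lia⟩
    constructor
    · intro h
      refine lt_of_le_of_ne (A.height_le_of_key_lt hsk hc h).1 (hne c ?_ ?_ ?_)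
      · rintro rfl; exact lt_irrefl _ h
      all_goals rw [mem_slab] at hc; lia
    · intro h
      by_contra! h'
      rcases h'.lt_or_eq with h' | h'
      · linarith [(A.height_le_of_key_lt hc hsk h').1]
      · rw [A.key_injOn (k + 1) hc hsk h'] at h
        exact lt_irrefl _ h
  rw [h1, h2, A.parity_slab_succ k fun y => A.height s (k + 1) < y]

theorem parity_above_eq {k : ℕ} {s : S} (hs : A.lo s ≤ k) (hs' : k < A.hi s) :
    A.parity (A.above k s) = A.parity (A.above (A.lo s) s) := by
  induction k, hs using Nat.le_induction with
  | base => rfl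
  | succ k hk ih => rw [← A.parity_above_succ hk hs', ih (by lia)]

open Classical in
/-- The boundary of a face. A face is given by the parities of the elements of the cycle space
above it. -/
noncomputable def faceBoundary (γ : A.cycleSpace → ZMod 2) (s : S) : ZMod 2 :=
  (if A.parity (A.above (A.lo s) s) = γ then 1 else 0) +
    if A.parity (insert s (A.above (A.lo s) s)) = γ then 1 else 0

open Classical in
theorem faceBoundary_eq (γ : A.cycleSpace → ZMod 2) {k : ℕ} {s : S} (hs : s ∈ A.slab k) :
    A.faceBoundary γ s = (if A.parity (A.above k s) = γ then 1 else 0) +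
      if A.parity (insert s (A.above k s)) = γ then 1 else 0 := by
  rw [mem_slab] at hs
  rw [faceBoundary, parity_insert_above, parity_insert_above, A.parity_above_eq hs.1 hs.2]

-- The strands arriving at a point are consecutive in their slab, so the labels between them cancel
-- and only those just above and just below the point remain.
open Classical in
theorem sum_faceBoundary_left (γ : A.cycleSpace → ZMod 2) (k : ℕ) (y : ℝ) :
    ∑ s ∈ A.slab k with A.height s (k + 1) = y, A.faceBoundary γ s =
      (if A.parity {c ∈ A.slab k | y < A.height c (k + 1)} = γ then 1 else 0) +
      if A.parity {c ∈ A.slab k | y ≤ A.height c (k + 1)} = γ then 1 else 0 := by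
  rw [← sum_levelSet_telescope (A.slab k) (A.key k) (fun s => A.height s (k + 1))
    (fun s hs c hc h => (A.height_le_of_key_lt hs hc h).2) (A.key_injOn k)
    (fun T => if A.parity T = γ then 1 else 0)]
  exact sum_congr rfl fun s hs => A.faceBoundary_eq γ (mem_filter.1 hs).1

open Classical in
theorem sum_faceBoundary_right (γ : A.cycleSpace → ZMod 2) (k : ℕ) (y : ℝ) :
    ∑ s ∈ A.slab k with A.height s k = y, A.faceBoundary γ s =
      (if A.parity {c ∈ A.slab k | y < A.height c k} = γ then 1 else 0) +
      if A.parity {c ∈ A.slab k | y ≤ A.height c k} = γ then 1 else 0 := by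
  rw [← sum_levelSet_telescope (A.slab k) (A.key k) (fun s => A.height s k)
    (fun s hs c hc h => (A.height_le_of_key_lt hs hc h).1) (A.key_injOn k)
    (fun T => if A.parity T = γ then 1 else 0)]
  exact sum_congr rfl fun s hs => A.faceBoundary_eq γ (mem_filter.1 hs).1

/-- At an end point, the strands on the left and those on the right each contribute the labels just
above and just below the point. These labels agree across the line, so everything cancels mod 2. -/
theorem faceBoundary_mem (γ : A.cycleSpace → ZMod 2) : A.faceBoundary γ ∈ A.cycleSpace := by
  classical
  intro k y
  by_cases hex : ∃ s, (A.lo s = k ∨ A.hi s = k) ∧ A.height s k = y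
  swap
  · rw [filter_false_of_mem fun s _ h => hex ⟨s, h⟩, sum_empty]
  obtain ⟨s₀, hs₀, hy₀⟩ := hex
  have hend : ∀ c, A.lo c ≤ k → k ≤ A.hi c → A.height c k = y → A.lo c = k ∨ A.hi c = k := by
    intro c h1 h2 h
    by_cases hc : c = s₀
    · rwa [hc]
    have := A.lo_lt_hi s₀
    exact A.meet c s₀ k hc h1 h2 (by lia) (by lia) (h.trans hy₀.symm)
  cases k with
  | zero =>
    have hs : ({s | (A.lo s = 0 ∨ A.hi s = 0) ∧ A.height s 0 = y} : Finset S) =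
        {s ∈ A.slab 0 | A.height s 0 = y} := by
      ext s
      have := A.lo_lt_hi s
      simp only [mem_filter, mem_univ, true_and, mem_slab]
      refine and_congr_left fun _ => ?_
      lia
    have hz : ∀ (P : ℝ → Prop) [DecidablePred P],
        A.parity {s ∈ A.slab 0 | P (A.height s 0)} = 0 := by
      intro P _
      funext z
      rw [Pi.zero_apply, ← A.sum_ends_eq_zero z 0 P, parity]
      refine sum_congr ?_ fun _ _ => rfl
      ext s
      have := A.lo_lt_hi s
      simp only [mem_filter, mem_univ, true_and, mem_slab]
      refine and_congr_left fun _ => ?_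
      lia
    rw [hs, A.sum_faceBoundary_right, hz fun t => y < t, hz fun t => y ≤ t,
      CharTwo.add_self_eq_zero]
  | succ k =>
    have hs : ({s | (A.lo s = k + 1 ∨ A.hi s = k + 1) ∧ A.height s (k + 1) = y} : Finset S) =
        {s ∈ A.slab k | A.height s (k + 1) = y} ∪
          {s ∈ A.slab (k + 1) | A.height s (k + 1) = y} := by
      ext s
      have := A.lo_lt_hi s
      have := hend s
      simp only [mem_filter, mem_univ, true_and, mem_slab, mem_union]
      rw [← or_and_right]
      refine and_congr_left fun h => ?_
      lia
    rw [hs, sum_union, A.sum_faceBoundary_left, A.sum_faceBoundary_right,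
      A.parity_slab_succ k fun t => y < t, A.parity_slab_succ k fun t => y ≤ t,
      CharTwo.add_self_eq_zero]
    rw [disjoint_left]
    intro s h1 h2
    have := hend s
    simp only [mem_filter, mem_slab] at h1 h2
    lia

theorem card_faceBoundary_ne_zero_le [Fintype (A.cycleSpace → ZMod 2)] (s : S) :
    #{γ | A.faceBoundary γ s ≠ 0} ≤ 2 := by
  classical
  refine (card_le_card (t := {A.parity (A.above (A.lo s) s),
    A.parity (insert s (A.above (A.lo s) s))}) fun γ hγ => ?_).trans card_le_two
  rw [mem_filter] at hγ
  rw [mem_insert, mem_singleton]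
  by_contra! h
  apply hγ.2
  rw [faceBoundary, if_neg h.1.symm, if_neg h.2.symm, add_zero]

/-- On a strand `s` only the labels of its two sides survive, and their values at `z` differ by `z
s`. -/
theorem sum_smul_faceBoundary [Fintype (A.cycleSpace → ZMod 2)] (z : A.cycleSpace) :
    ∑ γ, γ z • A.faceBoundary γ = z.1 := by
  classical
  funext s
  rw [Finset.sum_apply]
  simp only [Pi.smul_apply, faceBoundary, smul_eq_mul, mul_add, sum_add_distrib, mul_ite, mul_one,
    mul_zero, sum_ite_eq, mem_univ, if_true, parity_insert_above]
  rw [add_comm, add_assoc, CharTwo.add_self_eq_zero, add_zero]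

end StrandSystem

/-! ### Plane segments as strands -/

theorem exists_strictMono_forall_mem_exists_eq (T : Finset ℝ) :
    ∃ t : ℕ → ℝ, StrictMono t ∧ ∀ x ∈ T, ∃ k, t k = x := by
  suffices h : ∃ (t : ℕ → ℝ) (N : ℕ), StrictMono t ∧ (∀ k < N, t k ∈ T) ∧
      ∀ x ∈ T, ∃ k < N, t k = x by
    obtain ⟨t, N, ht, -, h⟩ := h
    exact ⟨t, ht, fun x hx => (h x hx).imp fun k hk => hk.2⟩
  induction T using Finset.induction_on_max with
  | empty => exact ⟨fun k => k, 0, Nat.strictMono_cast, by simp, by simp⟩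
  | insert a T ha ih =>
    obtain ⟨t, N, ht, h1, h2⟩ := ih
    -- From index `N` on, the sequence continues from the new maximum `a` in unit steps; truncated
    -- subtraction gives exactly `a` at `N`.
    refine ⟨fun k => if k < N then t k else a + (k - N : ℕ), N + 1, ?_, ?_, ?_⟩
    · refine strictMono_nat_of_lt_succ fun k => ?_
      by_cases hk : k + 1 < N
      · rw [if_pos (by lia), if_pos hk]
        exact ht (by lia)
      · by_cases hk' : k < N
        · rw [if_pos hk', if_neg hk]
          exact lt_add_of_lt_of_nonneg (ha _ (h1 k hk')) (Nat.cast_nonneg _)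
        · rw [if_neg hk', if_neg hk]
          have : ((k - N : ℕ) : ℝ) < (k + 1 - N : ℕ) := by
            rw [Nat.cast_lt]
            lia
          linarith
    · intro k hk
      by_cases hk' : k < N
      · simp only [hk', if_true, mem_insert]
        exact Or.inr (h1 k hk')
      · have : k = N := by lia
        simp [this]
    · intro x hx
      rcases mem_insert.1 hx with rfl | hx
      · exact ⟨N, by lia, by simp⟩
      · obtain ⟨k, hk, rfl⟩ := h2 x hx
        exact ⟨k, by lia, by simp [hk]⟩

namespace SimpleGraph

/-- Finitely many nondegenerate segments in the plane that meet only in common ends. -/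
structure SegmentSystem (S : Type*) where
  /-- one end of a segment -/
  src : S → Plane
  /-- the other end of a segment -/
  tgt : S → Plane
  src_ne_tgt : ∀ s, src s ≠ tgt s
  meet : ∀ s c, s ≠ c → ∀ x ∈ segment ℝ (src s) (tgt s), x ∈ segment ℝ (src c) (tgt c) →
    src s = x ∨ tgt s = x

/-- The first coordinate after a shear. -/
noncomputable def shear (τ : ℝ) (x : Plane) : ℝ := x 0 + τ * x 1

theorem eq_of_shear_eq {τ : ℝ} {x y : Plane} (h : shear τ x = shear τ y) (h' : x 1 = y 1) :
    x = y := by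
  ext i
  fin_cases i
  · simp only [shear, h'] at h
    simpa using h
  · exact h'

namespace SegmentSystem

universe u

variable {S : Type u} (A : SegmentSystem S)

theorem exists_shear_ne [Fintype S] : ∃ τ, ∀ s, shear τ (A.src s) ≠ shear τ (A.tgt s) := by
  -- Each segment with ends at different heights excludes one slope. For the others the quotient is
  -- the junk value 0, whose exclusion is harmless.
  obtain ⟨τ, hτ⟩ := Infinite.exists_notMem_finset
    (univ.image fun s => (A.tgt s 0 - A.src s 0) / (A.src s 1 - A.tgt s 1))
  refine ⟨τ, fun s h => ?_⟩
  by_cases h1 : A.src s 1 = A.tgt s 1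
  · exact A.src_ne_tgt s (eq_of_shear_eq h h1)
  · refine hτ (mem_image.2 ⟨s, mem_univ _, ?_⟩)
    rw [div_eq_iff (sub_ne_zero.2 h1)]
    simp only [shear] at h
    linarith

/-- The height of (the line through) a segment at sheared first coordinate `r`. -/
noncomputable def heightAt (τ : ℝ) (s : S) (r : ℝ) : ℝ :=
  A.src s 1 + (r - shear τ (A.src s)) / (shear τ (A.tgt s) - shear τ (A.src s)) *
    (A.tgt s 1 - A.src s 1)

theorem heightAt_src (τ : ℝ) (s : S) : A.heightAt τ s (shear τ (A.src s)) = A.src s 1 := by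
  simp [heightAt]

theorem heightAt_tgt {τ : ℝ} {s : S} (h : shear τ (A.src s) ≠ shear τ (A.tgt s)) :
    A.heightAt τ s (shear τ (A.tgt s)) = A.tgt s 1 := by
  rw [heightAt, div_self (sub_ne_zero.2 h.symm)]
  ring

theorem exists_mem_segment {τ : ℝ} {s : S} (h : shear τ (A.src s) ≠ shear τ (A.tgt s)) {r : ℝ}
    (h1 : min (shear τ (A.src s)) (shear τ (A.tgt s)) ≤ r)
    (h2 : r ≤ max (shear τ (A.src s)) (shear τ (A.tgt s))) :
    ∃ x ∈ segment ℝ (A.src s) (A.tgt s), shear τ x = r ∧ x 1 = A.heightAt τ s r := by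
  set a := shear τ (A.src s) with ha
  set b := shear τ (A.tgt s) with hb
  have hab : b - a ≠ 0 := sub_ne_zero.2 h.symm
  set θ := (r - a) / (b - a) with hθ
  have hθr : θ * (b - a) = r - a := div_mul_cancel₀ _ hab
  have hθ0 : 0 ≤ θ ∧ θ ≤ 1 := by
    rcases lt_or_gt_of_ne h with h | h
    · rw [min_eq_left h.le] at h1
      rw [max_eq_right h.le] at h2
      exact ⟨div_nonneg (by linarith) (by linarith), (div_le_one (by linarith)).2 (by linarith)⟩
    · rw [min_eq_right h.le] at h1
      rw [max_eq_left h.le] at h2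
      exact ⟨div_nonneg_of_nonpos (by linarith) (by linarith),
        (div_le_one_of_neg (by linarith)).2 (by linarith)⟩
  refine ⟨A.src s + θ • (A.tgt s - A.src s), ?_, ?_, ?_⟩
  · rw [segment_eq_image']
    exact ⟨θ, hθ0, rfl⟩
  · have : shear τ (A.src s + θ • (A.tgt s - A.src s)) = a + θ * (b - a) := by
      simp only [ha, hb, shear, PiLp.add_apply, PiLp.smul_apply, PiLp.sub_apply, smul_eq_mul]
      ring
    rw [this, hθr]
    ring
  · simp [heightAt, hθ, ha, hb]

theorem eq_of_heightAt_eq {τ : ℝ} (hτ : ∀ s, shear τ (A.src s) ≠ shear τ (A.tgt s)) {s c : S}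
    (hsc : s ≠ c) {r : ℝ}
    (h1 : min (shear τ (A.src s)) (shear τ (A.tgt s)) ≤ r)
    (h2 : r ≤ max (shear τ (A.src s)) (shear τ (A.tgt s)))
    (h3 : min (shear τ (A.src c)) (shear τ (A.tgt c)) ≤ r)
    (h4 : r ≤ max (shear τ (A.src c)) (shear τ (A.tgt c)))
    (h : A.heightAt τ s r = A.heightAt τ c r) :
    shear τ (A.src s) = r ∨ shear τ (A.tgt s) = r := by
  obtain ⟨x, hx, hxr, hx1⟩ := A.exists_mem_segment (hτ s) h1 h2
  obtain ⟨y, hy, hyr, hy1⟩ := A.exists_mem_segment (hτ c) h3 h4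
  have hxy : y = x := eq_of_shear_eq (τ := τ) (by rw [hxr, hyr]) (by rw [hx1, hy1, h])
  rcases A.meet s c hsc x hx (hxy ▸ hy) with h | h
  · exact Or.inl (by rw [h, hxr])
  · exact Or.inr (by rw [h, hxr])

theorem exists_heightAt_sub_eq (τ : ℝ) (s c : S) :
    ∃ m q : ℝ, ∀ r, A.heightAt τ c r - A.heightAt τ s r = m * r + q := by
  refine ⟨1 / (shear τ (A.tgt c) - shear τ (A.src c)) * (A.tgt c 1 - A.src c 1) -
    1 / (shear τ (A.tgt s) - shear τ (A.src s)) * (A.tgt s 1 - A.src s 1),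
    A.heightAt τ c 0 - A.heightAt τ s 0, fun r => ?_⟩
  simp only [heightAt]
  ring

open Classical in
/-- Every segment system has a family of even sets of segments that spans all even sets and covers
each segment at most twice. -/
theorem exists_two_basis [Fintype S] :
    ∃ (ι : Type u) (_ : Fintype ι) (B : ι → S → ZMod 2),
      (∀ i x, ∑ s with A.src s = x ∨ A.tgt s = x, B i s = 0) ∧
      (∀ s, #{i | B i s ≠ 0} ≤ 2) ∧
      ∀ z : S → ZMod 2, (∀ x, ∑ s with A.src s = x ∨ A.tgt s = x, z s = 0) →
        ∃ a : ι → ZMod 2, ∑ i, a i • B i = z := by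
  obtain ⟨τ, hτ⟩ := A.exists_shear_ne
  obtain ⟨t, ht, hT⟩ := exists_strictMono_forall_mem_exists_eq
    ((univ.image fun s => shear τ (A.src s)) ∪ univ.image fun s => shear τ (A.tgt s))
  have hsrc : ∀ s, ∃ k, t k = shear τ (A.src s) := fun s =>
    hT _ (mem_union_left _ (mem_image_of_mem _ (mem_univ s)))
  have htgt : ∀ s, ∃ k, t k = shear τ (A.tgt s) := fun s =>
    hT _ (mem_union_right _ (mem_image_of_mem _ (mem_univ s)))
  choose f hf using hsrc
  choose g hg using htgt
  have hfg : ∀ s, f s ≠ g s := fun s h => hτ s (by rw [← hf, ← hg, h])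
  have hmin : ∀ s, min (shear τ (A.src s)) (shear τ (A.tgt s)) = t (min (f s) (g s)) := fun s => by
    rw [← hf, ← hg, ht.monotone.map_min]
  have hmax : ∀ s, max (shear τ (A.src s)) (shear τ (A.tgt s)) = t (max (f s) (g s)) := fun s => by
    rw [← hf, ← hg, ht.monotone.map_max]
  let W : StrandSystem S :=
    { lo := fun s => min (f s) (g s)
      hi := fun s => max (f s) (g s)
      height := fun s k => A.heightAt τ s (t k)
      lo_lt_hi := fun s => min_lt_max.2 (hfg s)
      meet := by
        intro s c k hsc h1 h2 h3 h4 h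
        have := A.eq_of_heightAt_eq hτ hsc (r := t k)
          (by rw [hmin]; exact ht.monotone h1) (by rw [hmax]; exact ht.monotone h2)
          (by rw [hmin]; exact ht.monotone h3) (by rw [hmax]; exact ht.monotone h4) h
        rw [← hf, ← hg, ht.injective.eq_iff, ht.injective.eq_iff] at this
        lia
      ordered := by
        intro s c k hsc h1 h2 h3 h4
        have hk : t k < t (k + 1) := ht (by lia)
        -- A common point strictly between two consecutive lines would be an end of `s`, but all
        -- ends lie on lines.
        have hne : ∀ r, t k < r → r < t (k + 1) → A.heightAt τ c r - A.heightAt τ s r ≠ 0 := by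
          intro r hr hr' h
          have := A.eq_of_heightAt_eq hτ hsc (r := r)
            (by rw [hmin]; exact (ht.monotone h1).trans hr.le)
            (by rw [hmax]; exact hr'.le.trans (ht.monotone h2))
            (by rw [hmin]; exact (ht.monotone h3).trans hr.le)
            (by rw [hmax]; exact hr'.le.trans (ht.monotone h4)) (sub_eq_zero.1 h).symm
          rw [← hf, ← hg] at this
          rcases this with rfl | rfl
          · rw [ht.lt_iff_lt] at hr hr'
            lia
          · rw [ht.lt_iff_lt] at hr hr'
            lia
        obtain ⟨m, q, hmq⟩ := A.exists_heightAt_sub_eq τ s c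
        have hmid := hne ((t k + t (k + 1)) / 2) (by linarith) (by linarith)
        have hk1 := hmq (t k)
        have hk2 := hmq (t (k + 1))
        -- The difference of heights is affine; opposite signs on the two lines would put its root
        -- `-q / m` strictly between them.
        have hsame : 0 ≤ (m * t k + q) * (m * t (k + 1) + q) := by
          by_contra! hneg
          have hm : m ≠ 0 := by
            rintro rfl
            nlinarith [mul_self_nonneg q]
          have e1 : m * (-q / m) = -q := by field_simp
          have e2 : 0 < (-q / m - t k) * (t (k + 1) - -q / m) := by
            have : 0 < m ^ 2 * ((-q / m - t k) * (t (k + 1) - -q / m)) := by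
              have : m ^ 2 * ((-q / m - t k) * (t (k + 1) - -q / m)) =
                  (m * (-q / m) - m * t k) * (m * t (k + 1) - m * (-q / m)) := by ring
              rw [this, e1]
              linarith
            exact (mul_pos_iff_of_pos_left (by positivity)).1 this
          have e3 : t k < -q / m ∧ -q / m < t (k + 1) := by
            rcases pos_and_pos_or_neg_and_neg_of_mul_pos e2 with h | h
            · exact ⟨by linarith [h.1], by linarith [h.2]⟩
            · linarith [h.1, h.2]
          apply hne _ e3.1 e3.2
          rw [hmq, e1]
          ring
        rw [hmq] at hmid
        -- The sum is twice the difference at the midpoint, which is nonzero.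
        have hsum : (m * t k + q) + (m * t (k + 1) + q) ≠ 0 := by
          intro h
          apply hmid
          linarith
        rw [← hk1, ← hk2] at hsame hsum
        rcases mul_nonneg_iff.1 hsame with h | h
        · left
          refine ⟨by linarith [h.1], by linarith [h.2], ?_⟩
          have := lt_of_le_of_ne (add_nonneg h.1 h.2) hsum.symm
          linarith
        · right
          refine ⟨by linarith [h.1], by linarith [h.2], ?_⟩
          have := lt_of_le_of_ne (add_nonpos h.1 h.2) hsum
          linarith }
  have hends : ∀ x k, shear τ x = t k → ∀ s,
      ((W.lo s = k ∨ W.hi s = k) ∧ W.height s k = x 1) ↔ (A.src s = x ∨ A.tgt s = x) := by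
    intro x k hx s
    have h1 : (W.lo s = k ∨ W.hi s = k) ↔ (f s = k ∨ g s = k) := by
      change (min (f s) (g s) = k ∨ max (f s) (g s) = k) ↔ _
      lia
    rw [h1]
    change _ ∧ A.heightAt τ s (t k) = x 1 ↔ _
    constructor
    · rintro ⟨h | h, h'⟩
      · left
        rw [← h, hf, heightAt_src] at h'
        exact eq_of_shear_eq (τ := τ) (by rw [hx, ← hf, h]) h'
      · right
        rw [← h, hg, A.heightAt_tgt (hτ s)] at h'
        exact eq_of_shear_eq (τ := τ) (by rw [hx, ← hg, h]) h'
    · rintro (h | h)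
      · refine ⟨Or.inl (ht.injective ?_), ?_⟩
        · rw [hf, h, hx]
        · rw [← hx, ← h, heightAt_src]
      · refine ⟨Or.inr (ht.injective ?_), ?_⟩
        · rw [hg, h, hx]
        · rw [← hx, ← h, A.heightAt_tgt (hτ s)]
  have hmem : ∀ z : S → ZMod 2, z ∈ W.cycleSpace ↔
      ∀ x, ∑ s with A.src s = x ∨ A.tgt s = x, z s = 0 := by
    intro z
    constructor
    · intro hz x
      by_cases hx : ∃ s, A.src s = x ∨ A.tgt s = x
      · obtain ⟨k, hk⟩ : ∃ k, shear τ x = t k := by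
          obtain ⟨s, rfl | rfl⟩ := hx
          · exact ⟨f s, (hf s).symm⟩
          · exact ⟨g s, (hg s).symm⟩
        rw [← hz k (x 1)]
        exact sum_congr (filter_congr fun s _ => (hends x k hk s).symm) fun _ _ => rfl
      · rw [filter_false_of_mem fun s _ h => hx ⟨s, h⟩, sum_empty]
    · intro hz k y
      -- This is the point of height `y` whose sheared coordinate is `t k`.
      rw [← hz !₂[t k - τ * y, y]]
      refine sum_congr (filter_congr fun s _ => ?_) fun _ _ => rfl
      exact hends !₂[t k - τ * y, y] k (by simp [shear]) s
  refine ⟨W.cycleSpace → ZMod 2, inferInstance, W.faceBoundary,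
    fun γ => (hmem _).1 (W.faceBoundary_mem γ),
    fun s => ?_, fun z hz => ⟨fun γ => γ ⟨z, (hmem z).2 hz⟩, W.sum_smul_faceBoundary ⟨z, _⟩⟩⟩
  convert W.card_faceBoundary_ne_zero_le s

end SegmentSystem

end SimpleGraph

/-! ### From segments to the edges of a planar graph -/

namespace SimpleGraph

universe u

variable {V : Type u}

theorem sum_range_add_succ_charTwo (f : ℕ → ZMod 2) (n : ℕ) :
    ∑ i ∈ range n, (f i + f (i + 1)) = f 0 + f n := by
  induction n with
  | zero => simp [CharTwo.add_self_eq_zero]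
  | succ n ih =>
    rw [sum_range_succ, ih]
    calc _ = f 0 + f (n + 1) + (f n + f n) := by ring
      _ = _ := by rw [CharTwo.add_self_eq_zero, add_zero]

/-- The ends of each segment are distinct, so its indicator is a sum of two, and the inner bends
cancel mod 2. -/
theorem sum_polygon_ends {α : Type*} [DecidableEq α] (p : ℕ → α) (n : ℕ) (hp : ∀ i < n, p i ≠ p (i + 1)) (x : α) :
    ∑ i : Fin n, (if p i = x ∨ p (i + 1) = x then 1 else 0 : ZMod 2) =
      (if p 0 = x then 1 else 0) + if p n = x then 1 else 0 := by
  rw [← sum_range_add_succ_charTwo (fun i => if p i = x then 1 else 0) n,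
    Fin.sum_univ_eq_sum_range (fun i => (if p i = x ∨ p (i + 1) = x then 1 else 0 : ZMod 2)) n]
  refine sum_congr rfl fun i hi => ?_
  have := hp i (mem_range.1 hi)
  by_cases h1 : p i = x
  · have h2 : p (i + 1) ≠ x := fun h => this (h1.trans h.symm)
    simp [h1, h2]
  · simp [h1]

open Classical in
/-- The cycle space of `G` over `ZMod 2`: the functions on the edges that sum to zero at each
vertex. -/
noncomputable def binaryCycleSpace [Fintype V] (G : SimpleGraph V) :
    Submodule (ZMod 2) (G.edgeSet → ZMod 2) where
  carrier := {z | ∀ v, ∑ e with v ∈ e.1, z e = 0}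
  zero_mem' := by intro v; simp
  add_mem' := by
    intro a b ha hb v
    simp only [Pi.add_apply, sum_add_distrib, ha v, hb v, add_zero]
  smul_mem' := by
    intro r a ha v
    simp only [Pi.smul_apply, ← smul_sum, ha v, smul_zero]

/-- Together with its counterpart for the last segment, this ensures that where arcs of different
edges meet, the segments involved meet in their own ends. -/
theorem eq_zero_of_start_mem_segment {n : ℕ} {p : ℕ → Plane}
    (hp : ∀ i < n, p i ≠ p (i + 1))
    (hmeet : ∀ i j, i < j → j < n → ∀ x ∈ segment ℝ (p i) (p (i + 1)),
      x ∈ segment ℝ (p j) (p (j + 1)) → j = i + 1 ∧ x = p j)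
    {i : ℕ} (hi : i < n)
    (h : p 0 ∈ segment ℝ (p i) (p (i + 1))) : i = 0 := by
  by_contra h0
  obtain ⟨h1, h2⟩ := hmeet 0 i (by lia) hi (p 0) (left_mem_segment ℝ _ _) h
  rw [h1] at h2
  exact hp 0 (by lia) h2

theorem succ_eq_of_end_mem_segment {n : ℕ} {p : ℕ → Plane}
    (hp : ∀ i < n, p i ≠ p (i + 1))
    (hmeet : ∀ i j, i < j → j < n → ∀ x ∈ segment ℝ (p i) (p (i + 1)),
      x ∈ segment ℝ (p j) (p (j + 1)) → j = i + 1 ∧ x = p j)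
    {i : ℕ} (hi : i < n)
    (h : p n ∈ segment ℝ (p i) (p (i + 1))) : i + 1 = n := by
  by_contra h0
  obtain ⟨k, rfl⟩ : ∃ k, n = k + 1 := ⟨n - 1, by lia⟩
  obtain ⟨h1, h2⟩ := hmeet i k (by lia) (by lia) _ h (right_mem_segment ℝ _ _)
  exact hp k (by lia) h2.symm

/-- A bend of a polygonal arc is an end of the two segments next to it only. -/
theorem eq_or_eq_of_bend_eq {n : ℕ} {p : ℕ → Plane}
    (hmeet : ∀ i j, i < j → j < n → ∀ x ∈ segment ℝ (p i) (p (i + 1)),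
      x ∈ segment ℝ (p j) (p (j + 1)) → j = i + 1 ∧ x = p j)
    {i j : ℕ} (hi : i + 1 < n) (hj : j < n)
    (h : p j = p (i + 1) ∨ p (j + 1) = p (i + 1)) : j = i ∨ j = i + 1 := by
  have hmem : p (i + 1) ∈ segment ℝ (p j) (p (j + 1)) := by
    rcases h with h | h
    · rw [← h]; exact left_mem_segment ℝ _ _
    · rw [← h]; exact right_mem_segment ℝ _ _
  by_contra! hne
  rcases lt_or_gt_of_ne hne.1 with hlt | hgt
  · have := hmeet j (i + 1) (by lia) hi _ hmem (left_mem_segment ℝ _ _)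
    lia
  · have := hmeet i j hgt hj _ (right_mem_segment ℝ _ _) hmem
    lia

open Classical in
/-- The easy half of MacLane's planarity criterion. -/
theorem IsPlanar.exists_two_basis [Fintype V] {G : SimpleGraph V} (hG : G.IsPlanar) :
    ∃ (ι : Type u) (_ : Fintype ι) (B : ι → G.edgeSet → ZMod 2),
      (∀ i, B i ∈ G.binaryCycleSpace) ∧ (∀ e, #{i | B i e ≠ 0} ≤ 2) ∧
      ∀ z ∈ G.binaryCycleSpace, ∃ a : ι → ZMod 2, ∑ i, a i • B i = z := by
  obtain ⟨D⟩ := hG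
  have harc : ∀ e : G.edgeSet, ∃ (a b : V) (n : ℕ) (p : ℕ → Plane), e.1 = s(a, b) ∧ a ≠ b ∧
      p 0 = D.pos a ∧ p n = D.pos b ∧
      D.arc e.1 = {x | ∃ i < n, x ∈ segment ℝ (p i) (p (i + 1))} ∧
      (∀ i < n, p i ≠ p (i + 1)) ∧
      (∀ i j, i < j → j < n → ∀ x ∈ segment ℝ (p i) (p (i + 1)),
        x ∈ segment ℝ (p j) (p (j + 1)) → j = i + 1 ∧ x = p j) := by
    rintro ⟨e, he⟩
    induction e with | _ a b
    obtain ⟨n, p, h⟩ := D.isPolygonalArc a b he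
    exact ⟨a, b, n, p, rfl, G.ne_of_adj he, h⟩
  choose a b n p heq hab hp0 hpn hA hp hmeet using harc
  have hn : ∀ e, 0 < n e := by
    intro e
    by_contra h
    have h0 : n e = 0 := by lia
    have := hpn e
    rw [h0, hp0] at this
    exact hab e (D.pos_injective this)
  have hvert : ∀ e w, w ∈ e.1 → D.pos w = p e 0 ∨ D.pos w = p e (n e) := by
    intro e w hw
    rw [heq, Sym2.mem_iff] at hw
    rcases hw with rfl | rfl
    · exact Or.inl (hp0 e).symm
    · exact Or.inr (hpn e).symm
  have hcross : ∀ e f, e ≠ f → ∀ x ∈ D.arc e.1, x ∈ D.arc f.1 → x = p e 0 ∨ x = p e (n e) := by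
    intro e f hef x hx hx'
    obtain ⟨w, hw, -, rfl⟩ := D.no_crossing e.1 e.2 f.1 f.2 (fun h => hef (Subtype.ext h)) x hx hx'
    exact hvert e w hw
  let A : SegmentSystem (Σ e : G.edgeSet, Fin (n e)) :=
    { src := fun s => p s.1 s.2
      tgt := fun s => p s.1 (s.2 + 1)
      src_ne_tgt := fun s => hp s.1 s.2 s.2.2
      meet := by
        rintro ⟨e, i⟩ ⟨f, j⟩ hne x hx hx'
        dsimp only at hx hx' ⊢
        by_cases hef : e = f
        · subst hef
          have hij : (i : ℕ) ≠ j := fun h => hne (by rw [Fin.ext h])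
          rcases lt_or_gt_of_ne hij with h | h
          · obtain ⟨h1, rfl⟩ := hmeet e i j h j.2 x hx hx'
            exact Or.inr (by rw [h1])
          · obtain ⟨h1, rfl⟩ := hmeet e j i h i.2 x hx' hx
            exact Or.inl rfl
        · have h1 : x ∈ D.arc e.1 := by rw [hA]; exact ⟨i, i.2, hx⟩
          have h2 : x ∈ D.arc f.1 := by rw [hA]; exact ⟨j, j.2, hx'⟩
          rcases hcross e f hef x h1 h2 with rfl | rfl
          · left
            rw [eq_zero_of_start_mem_segment (hp e) (hmeet e) i.2 hx]
          · right
            rw [succ_eq_of_end_mem_segment (hp e) (hmeet e) i.2 hx] }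
  have hsum : ∀ (z : G.edgeSet → ZMod 2) (x : Plane),
      ∑ s with A.src s = x ∨ A.tgt s = x, z s.1 =
        ∑ e, z e * ((if p e 0 = x then 1 else 0) + if p e (n e) = x then 1 else 0) := by
    intro z x
    rw [sum_filter, Fintype.sum_sigma]
    refine sum_congr rfl fun e _ => ?_
    rw [← sum_polygon_ends (p e) (n e) (hp e) x, mul_sum]
    refine sum_congr rfl fun i _ => ?_
    rw [mul_ite, mul_one, mul_zero]
  have hsum_pos : ∀ (z : G.edgeSet → ZMod 2) (v : V),
      ∑ s with A.src s = D.pos v ∨ A.tgt s = D.pos v, z s.1 = ∑ e with v ∈ e.1, z e := by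
    intro z v
    rw [hsum, sum_filter]
    refine sum_congr rfl fun e _ => ?_
    simp only [hp0, hpn, D.pos_injective.eq_iff]
    have hv : v ∈ e.1 ↔ a e = v ∨ b e = v := by
      rw [heq e, Sym2.mem_iff, eq_comm, @eq_comm _ v]
    have hab' := hab e
    by_cases h1 : a e = v
    · have h2 : b e ≠ v := fun h => hab' (h1.trans h.symm)
      simp [hv, h1, h2]
    · by_cases h2 : b e = v <;> simp [hv, h1, h2]
  obtain ⟨ι, hι, B, hB, hB2, hspan⟩ := A.exists_two_basis
  -- A bend is an end of exactly two segments, both of the same edge, so evenness there makes `B i`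
  -- constant along each edge.
  have hconst : ∀ i e (j : ℕ) (hj : j < n e), B i ⟨e, j, hj⟩ = B i ⟨e, 0, hn e⟩ := by
    intro i e j
    induction j with
    | zero => intro _; rfl
    | succ j ih =>
      intro hj
      rw [← ih (by lia)]
      have h := hB i (p e (j + 1))
      have hset : ({s | A.src s = p e (j + 1) ∨ A.tgt s = p e (j + 1)} :
          Finset (Σ e : G.edgeSet, Fin (n e))) =
          {⟨e, j + 1, hj⟩, ⟨e, j, by lia⟩} := by
        ext ⟨f, k⟩
        simp only [mem_filter, mem_univ, true_and, mem_insert, mem_singleton]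
        constructor
        · intro hk
          have hfe : f = e := by
            by_contra hfe
            have h1 : p e (j + 1) ∈ D.arc e.1 := by
              rw [hA]; exact ⟨j + 1, hj, left_mem_segment ℝ _ _⟩
            have h2 : p e (j + 1) ∈ D.arc f.1 := by
              rw [hA]
              refine ⟨k, k.2, ?_⟩
              rcases hk with hk | hk
              · rw [← hk]; exact left_mem_segment ℝ _ _
              · rw [← hk]; exact right_mem_segment ℝ _ _
            rcases hcross e f (Ne.symm hfe) _ h1 h2 with h | h
            · have := eq_zero_of_start_mem_segment (hp e) (hmeet e) hj
                (h ▸ left_mem_segment ℝ _ _)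
              lia
            · have := succ_eq_of_end_mem_segment (hp e) (hmeet e) (i := j) (by lia)
                (h ▸ right_mem_segment ℝ _ _)
              lia
          subst hfe
          rcases eq_or_eq_of_bend_eq (hmeet f) hj k.2 hk with hk | hk
          · right
            congr 1
            exact Fin.ext hk
          · left
            congr 1
            exact Fin.ext hk
        · rintro (hk | hk)
          · cases hk
            exact Or.inl rfl
          · cases hk
            exact Or.inr rfl
      rw [hset, sum_insert, sum_singleton] at h
      · exact CharTwo.add_eq_zero.1 h
      · rw [mem_singleton]
        intro h
        cases h
  refine ⟨ι, hι, fun i e => B i ⟨e, 0, hn e⟩, fun i v => ?_, fun e => hB2 _, fun z hz => ?_⟩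
  · rw [← hsum_pos, ← hB i (D.pos v)]
    exact sum_congr rfl fun s _ => (hconst i s.1 s.2 s.2.2).symm
  · obtain ⟨c, hc⟩ := hspan (fun s => z s.1) (fun x => by
      by_cases hx : ∃ v, x = D.pos v
      · obtain ⟨v, rfl⟩ := hx
        rw [hsum_pos]
        exact hz v
      · rw [hsum]
        refine sum_eq_zero fun e _ => ?_
        rw [if_neg fun h => hx ⟨a e, by rw [← h, hp0]⟩,
          if_neg fun h => hx ⟨b e, by rw [← h, hpn]⟩, add_zero, mul_zero])
    refine ⟨c, ?_⟩
    funext e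
    have := congrFun hc ⟨e, 0, hn e⟩
    simpa [Finset.sum_apply] using this

end SimpleGraph

/-! ### The edge bound and a vertex of small degree -/

namespace SimpleGraph

universe u

variable {V : Type u}

theorem IsPlanar.mono {G G' : SimpleGraph V} (hG : G.IsPlanar) (h : G' ≤ G) : G'.IsPlanar := by
  obtain ⟨D⟩ := hG
  have hE := edgeSet_mono h
  exact ⟨{
    pos := D.pos
    arc := D.arc
    pos_injective := D.pos_injective
    isPolygonalArc := fun u v huv => D.isPolygonalArc u v (h huv)
    mem_of_pos_mem_arc := fun e he => D.mem_of_pos_mem_arc e (hE he)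
    no_crossing := fun e he f hf => D.no_crossing e (hE he) f (hE hf) }⟩

open Classical in
theorem card_filter_mem_edge (G : SimpleGraph V) (U : Finset V)
    (hU : ∀ e : G.edgeSet, ∀ v ∈ e.1, v ∈ U) (e : G.edgeSet) : #{v ∈ U | v ∈ e.1} = 2 := by
  obtain ⟨e, he⟩ := e
  induction e with | _ a b
  have : ({v ∈ U | v ∈ s(a, b)} : Finset V) = {a, b} := by
    ext v
    simp only [mem_filter, Sym2.mem_iff, mem_insert, mem_singleton, and_iff_right_iff_imp]
    exact fun hv => hU ⟨_, he⟩ v (Sym2.mem_iff.2 hv)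
  rw [this, card_pair (G.ne_of_adj he)]

variable [Fintype V]

-- Rank-nullity for the boundary map: each edge has two ends, so boundaries have coordinate sum zero
-- and the rank is less than `#U`.
open Classical in
theorem card_edgeSet_lt_finrank_add_card (G : SimpleGraph V) (U : Finset V) (hne : U.Nonempty)
    (hU : ∀ e : G.edgeSet, ∀ v ∈ e.1, v ∈ U) :
    Fintype.card G.edgeSet < Module.finrank (ZMod 2) G.binaryCycleSpace + #U := by
  let d : (G.edgeSet → ZMod 2) →ₗ[ZMod 2] (U → ZMod 2) :=
    { toFun := fun z v => ∑ e with v.1 ∈ e.1, z e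
      map_add' := fun a b => by funext v; simp [sum_add_distrib]
      map_smul' := fun r a => by funext v; simp [mul_sum] }
  have hker : LinearMap.ker d ≤ G.binaryCycleSpace := by
    intro z hz v
    by_cases hv : v ∈ U
    · exact congrFun (LinearMap.mem_ker.1 hz) ⟨v, hv⟩
    · rw [filter_false_of_mem fun e _ h => hv (hU e v h), sum_empty]
  have hzero : ∀ z, ∑ v, d z v = 0 := by
    intro z
    change ∑ v : U, ∑ e with v.1 ∈ e.1, z e = 0
    rw [sum_coe_sort U fun v => ∑ e : G.edgeSet with v ∈ e.1, z e]
    simp only [sum_filter]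
    rw [sum_comm]
    refine sum_eq_zero fun e _ => ?_
    rw [← sum_filter, sum_const, card_filter_mem_edge G U hU, two_nsmul,
      CharTwo.add_self_eq_zero]
  have hrange : LinearMap.range d ≠ ⊤ := by
    intro h
    obtain ⟨u, hu⟩ := hne
    obtain ⟨z, hz⟩ := LinearMap.range_eq_top.1 h (Pi.single ⟨u, hu⟩ 1)
    have := hzero z
    rw [hz] at this
    simp at this
  have h1 := Submodule.finrank_lt hrange
  have h2 := d.finrank_range_add_finrank_ker
  have h3 := Submodule.finrank_mono hker
  rw [Module.finrank_fintype_fun_eq_card, Fintype.card_coe] at h1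
  rw [Module.finrank_fintype_fun_eq_card] at h2
  lia

-- An edge of the support has a further support edge at each of its ends; these two differ, because
-- the graph is simple.
open Classical in
theorem three_le_card_support_of_mem_binaryCycleSpace {G : SimpleGraph V} {z : G.edgeSet → ZMod 2}
    (hz : z ∈ G.binaryCycleSpace) (hz0 : z ≠ 0) : 3 ≤ #{e | z e ≠ 0} := by
  have other : ∀ e v, v ∈ e.1 → z e ≠ 0 → ∃ f, f ≠ e ∧ v ∈ f.1 ∧ z f ≠ 0 := by
    intro e v hv he
    by_contra! h
    have := hz v
    rw [sum_eq_single_of_mem e (by simpa using hv)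
      fun f hf hfe => h f hfe (mem_filter.1 hf).2] at this
    exact he this
  obtain ⟨e, he⟩ := Function.ne_iff.1 hz0
  obtain ⟨⟨a, b⟩, hab⟩ : ∃ x : V × V, e.1 = s(x.1, x.2) := by
    obtain ⟨e, _⟩ := e
    induction e with | _ a b
    exact ⟨(a, b), rfl⟩
  have hne : a ≠ b := by
    have := e.2
    rw [hab] at this
    exact G.ne_of_adj this
  obtain ⟨f, hfe, haf, hf⟩ := other e a (by simp [hab]) he
  obtain ⟨g, hge, hbg, hg⟩ := other e b (by simp [hab]) he
  have hfg : f ≠ g := by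
    rintro rfl
    exact hfe (Subtype.ext (by rw [hab]; exact (Sym2.mem_and_mem_iff hne).1 ⟨haf, hbg⟩))
  have hsub : ({e, f, g} : Finset G.edgeSet) ⊆ ({e | z e ≠ 0} : Finset G.edgeSet) := by
    intro x hx
    simp only [mem_insert, mem_singleton] at hx
    rcases hx with rfl | rfl | rfl <;> simpa
  calc 3 = #({e, f, g} : Finset G.edgeSet) := by
        rw [card_eq_three.2 ⟨e, f, g, hfe.symm, hge.symm, hfg, rfl⟩]
    _ ≤ _ := card_le_card hsub

open Classical in
/-- The edge bound for planar graphs: `U` is any nonempty set of vertices that contains the ends of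
all edges. -/
theorem IsPlanar.card_edgeSet_add_three_le {G : SimpleGraph V} (hG : G.IsPlanar) (U : Finset V)
    (hne : U.Nonempty) (hU : ∀ e : G.edgeSet, ∀ v ∈ e.1, v ∈ U) :
    Nat.card G.edgeSet + 3 ≤ 3 * #U := by
  rw [Nat.card_eq_fintype_card]
  obtain ⟨ι, _, B, hB, hB2, hspan⟩ := hG.exists_two_basis
  -- Zero members are dropped: they add nothing to the span, and the lower bound 3 on supports fails
  -- for them.
  let I : Finset ι := {i | B i ≠ 0}
  have h1 := card_edgeSet_lt_finrank_add_card G U hne hU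
  have h2 : Module.finrank (ZMod 2) G.binaryCycleSpace ≤ #I := by
    have hle : G.binaryCycleSpace ≤
        Submodule.span (ZMod 2) (I.image B : Set (G.edgeSet → ZMod 2)) := by
      intro z hz
      obtain ⟨a, rfl⟩ := hspan z hz
      refine Submodule.sum_mem _ fun i _ => Submodule.smul_mem _ _ ?_
      by_cases hi : B i = 0
      · rw [hi]; exact Submodule.zero_mem _
      · exact Submodule.subset_span (mem_coe.2 (mem_image_of_mem B (by simp [I, hi])))
    exact (Submodule.finrank_mono hle).trans
      ((finrank_span_finset_le_card _).trans card_image_le)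
  have h3 : #I * 3 ≤ Fintype.card G.edgeSet * 2 := by
    refine card_mul_le_card_mul (s := I) (t := univ) (fun i e => B i e ≠ 0) (fun i hi => ?_)
      fun e _ => ?_
    · exact three_le_card_support_of_mem_binaryCycleSpace (hB i) (mem_filter.1 hi).2
    · exact (card_le_card (filter_subset_filter _ (subset_univ I))).trans (hB2 e)
  lia

open Classical in
/-- Every nonempty set of edges of a planar graph has a vertex of degree between 1 and 5. -/
theorem IsPlanar.exists_degree_le_five {G : SimpleGraph V} (hG : G.IsPlanar)
    (F : Finset (Sym2 V)) (hF : (F : Set (Sym2 V)) ⊆ G.edgeSet) (hne : F.Nonempty) :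
    ∃ e ∈ F, ∃ v ∈ e, #{f ∈ F | v ∈ f} ≤ 5 := by
  by_contra! hlarge
  have hset : (fromEdgeSet (F : Set (Sym2 V))).edgeSet = F := by
    rw [edgeSet_fromEdgeSet, sdiff_eq_left, Set.disjoint_left]
    exact fun e he => G.not_isDiag_of_mem_edgeSet (hF he)
  have hG' : (fromEdgeSet (F : Set (Sym2 V))).IsPlanar := hG.mono (by
    rw [← edgeSet_subset_edgeSet, hset]
    exact hF)
  let U : Finset V := {v | ∃ e ∈ F, v ∈ e}
  have hU : ∀ e : (fromEdgeSet (F : Set (Sym2 V))).edgeSet, ∀ v ∈ e.1, v ∈ U := by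
    intro e v hv
    have : e.1 ∈ (F : Set (Sym2 V)) := hset.subset e.2
    exact mem_filter.2 ⟨mem_univ _, e.1, this, hv⟩
  have hUne : U.Nonempty := by
    obtain ⟨e, he⟩ := hne
    induction e with | _ a b
    exact ⟨a, mem_filter.2 ⟨mem_univ _, _, he, Sym2.mem_mk_left a b⟩⟩
  have hcard : Nat.card (fromEdgeSet (F : Set (Sym2 V))).edgeSet = #F := by
    rw [hset, Nat.card_coe_set_eq, Set.ncard_coe_finset]
  have h1 := hG'.card_edgeSet_add_three_le U hUne hU
  have h2 : #U * 6 ≤ #F * 2 := by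
    refine card_mul_le_card_mul (fun v e => v ∈ e) (fun v hv => ?_) fun e he => ?_
    · obtain ⟨-, e, he, hv⟩ := mem_filter.1 hv
      exact hlarge e he v hv
    · exact (card_filter_mem_edge _ U hU ⟨e, by rw [hset]; exact he⟩).le
  rw [hcard] at h1
  lia

end SimpleGraph

/-! ### Greedy colorings -/

namespace SimpleGraph

variable {V : Type*} [Fintype V]

/-- A proper coloring of some vertices extends to all vertices greedily. -/
theorem exists_vertexColoring_extending (G : SimpleGraph V) [DecidableRel G.Adj] {k : ℕ}
    (hk : G.maxDegree < k) (X : Set V) (c₀ : V → Fin k)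
    (h₀ : ∀ u ∈ X, ∀ v ∈ X, G.Adj u v → c₀ u ≠ c₀ v) :
    ∃ c : V → Fin k, (∀ u v, G.Adj u v → c u ≠ c v) ∧ ∀ u ∈ X, c u = c₀ u := by
  classical
  suffices h : ∀ T : Finset V, ∃ c : V → Fin k,
      (∀ u v, u ∈ X ∨ u ∈ T → v ∈ X ∨ v ∈ T → G.Adj u v → c u ≠ c v) ∧ ∀ u ∈ X, c u = c₀ u by
    obtain ⟨c, h1, h2⟩ := h univ
    exact ⟨c, fun u v => h1 u v (Or.inr (mem_univ _)) (Or.inr (mem_univ _)), h2⟩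
  intro T
  induction T using Finset.induction_on with
  | empty => exact ⟨c₀, fun u v hu hv => h₀ u (by simpa using hu) v (by simpa using hv), by simp⟩
  | insert a T ha ih =>
    obtain ⟨c, h1, h2⟩ := ih
    by_cases haX : a ∈ X
    · refine ⟨c, fun u v hu hv => h1 u v ?_ ?_, h2⟩
      · rcases hu with hu | hu
        · exact Or.inl hu
        · rcases mem_insert.1 hu with rfl | hu
          exacts [Or.inl haX, Or.inr hu]
      · rcases hv with hv | hv
        · exact Or.inl hv
        · rcases mem_insert.1 hv with rfl | hv
          exacts [Or.inl haX, Or.inr hv]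
    obtain ⟨x, -, hx⟩ := exists_mem_notMem_of_card_lt_card (t := univ)
      (s := (G.neighborFinset a).image c) (by
        rw [card_univ, Fintype.card_fin]
        exact (card_image_le.trans (G.degree_le_maxDegree a)).trans_lt hk)
    have hx' : ∀ w, G.Adj a w → x ≠ c w := fun w hw h =>
      hx (mem_image.2 ⟨w, (G.mem_neighborFinset a w).2 hw, h.symm⟩)
    have hmem : ∀ {u}, u ≠ a → u ∈ X ∨ u ∈ insert a T → u ∈ X ∨ u ∈ T := fun hne h =>
      h.imp_right fun h => (mem_insert.1 h).resolve_left hne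
    refine ⟨Function.update c a x, fun u v hu hv huv => ?_, fun u hu => ?_⟩
    · by_cases hua : u = a
      · subst hua
        rw [Function.update_self, Function.update_of_ne huv.ne']
        exact hx' v huv
      · by_cases hva : v = a
        · subst hva
          rw [Function.update_self, Function.update_of_ne hua]
          exact (hx' u huv.symm).symm
        · rw [Function.update_of_ne hua, Function.update_of_ne hva]
          exact h1 u v (hmem hua hu) (hmem hva hv) huv
    · rw [Function.update_of_ne (ne_of_mem_of_not_mem hu haX), h2 u hu]

open Classical in
/-- In a planar graph with colored vertices, a coloring of a matching `M` extends to any further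
set `F` of edges. -/
theorem IsPlanar.exists_edgeColoring_extending {G : SimpleGraph V} [DecidableRel G.Adj]
    (hG : G.IsPlanar) (M : Finset (Sym2 V)) (hM : ∀ e ∈ M, e ∈ G.edgeSet)
    (hmatch : ∀ v, #{e ∈ M | v ∈ e} ≤ 1) (vc : V → Fin (G.maxDegree + 7))
    (c₀ : Sym2 V → Fin (G.maxDegree + 7)) (h₀ : ∀ e ∈ M, ∀ v ∈ e, vc v ≠ c₀ e)
    (F : Finset (Sym2 V)) (hF : ∀ e ∈ F, e ∈ G.edgeSet) (hMF : Disjoint M F) :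
    ∃ c : Sym2 V → Fin (G.maxDegree + 7), (∀ e ∈ M, c e = c₀ e) ∧
      (∀ e ∈ M ∪ F, ∀ f ∈ M ∪ F, e ≠ f → ∀ v ∈ e, v ∈ f → c e ≠ c f) ∧
      ∀ e ∈ M ∪ F, ∀ v ∈ e, vc v ≠ c e := by
  induction F using Finset.strongInduction with
  | H F ih =>
  rcases F.eq_empty_or_nonempty with rfl | hne
  · refine ⟨c₀, fun _ _ => rfl, fun e he f hf hef v hve hvf => ?_, by simpa using h₀⟩
    rw [union_empty] at he hf
    exact absurd (card_le_one.1 (hmatch v) e (by simp [he, hve]) f (by simp [hf, hvf])) hef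
  obtain ⟨e, he, u, hu, hdeg⟩ := hG.exists_degree_le_five F hF hne
  obtain ⟨v, rfl⟩ := hu
  have heM : s(u, v) ∉ M := fun h => Finset.disjoint_left.1 hMF h he
  obtain ⟨c, hc₀, hcc, hcv⟩ := ih (F.erase s(u, v)) (erase_ssubset he)
    (fun f hf => hF f (mem_of_mem_erase hf)) (hMF.mono_right (erase_subset _ _))
  set E := M ∪ F.erase s(u, v) with hE
  have heE : s(u, v) ∉ E := by simp [hE, heM]
  have hEG : ∀ f ∈ E, f ∈ G.edgeSet := by
    intro f hf
    rcases mem_union.1 hf with hf | hf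
    · exact hM f hf
    · exact hF f (mem_of_mem_erase hf)
  have hcu : #{f ∈ E | u ∈ f} ≤ 5 := by
    rw [hE, filter_union, filter_erase]
    -- Without the edge itself, at most 4 edges of `F` remain at `u`; the matching adds at most one.
    have h1 : #(({f ∈ F | u ∈ f} : Finset (Sym2 V)).erase s(u, v)) + 1 ≤ 5 := by
      rw [card_erase_add_one (by simp [he])]
      exact hdeg
    have h2 := card_union_le ({f ∈ M | u ∈ f} : Finset (Sym2 V))
      (({f ∈ F | u ∈ f} : Finset (Sym2 V)).erase s(u, v))
    have h3 := hmatch u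
    lia
  have hcv' : #{f ∈ E | v ∈ f} + 1 ≤ G.maxDegree := by
    refine le_trans ?_ (G.degree_le_maxDegree v)
    rw [← G.card_incidenceFinset_eq_degree, ← card_insert_of_notMem (a := s(u, v))
      (fun h => heE (mem_filter.1 h).1)]
    refine card_le_card fun f hf => ?_
    rw [mem_incidenceFinset, incidenceSet, Set.mem_ofPred_eq]
    rcases mem_insert.1 hf with rfl | hf
    · exact ⟨hF _ he, Sym2.mem_mk_right u v⟩
    · exact ⟨hEG f (mem_filter.1 hf).1, (mem_filter.1 hf).2⟩
  -- Forbidden colors: at most 5 from edges at `u`, Δ - 1 from edges at `v`, and 2 from the ends,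
  -- which leaves one of the Δ + 7 free.
  obtain ⟨x, -, hx⟩ := exists_mem_notMem_of_card_lt_card (t := univ)
    (s := (({f ∈ E | u ∈ f} ∪ {f ∈ E | v ∈ f} : Finset (Sym2 V)).image c) ∪ {vc u, vc v}) (by
      rw [card_univ, Fintype.card_fin]
      have h1 := card_union_le (({f ∈ E | u ∈ f} ∪ {f ∈ E | v ∈ f} : Finset (Sym2 V)).image c)
        {vc u, vc v}
      have h2 := card_union_le ({f ∈ E | u ∈ f} : Finset (Sym2 V)) {f ∈ E | v ∈ f}
      have h3 := card_image_le (s := ({f ∈ E | u ∈ f} ∪ {f ∈ E | v ∈ f} : Finset (Sym2 V))) (f := c)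
      have h4 := card_le_two (a := vc u) (b := vc v)
      lia)
  have hxv : ∀ w ∈ s(u, v), vc w ≠ x := by
    rintro w hw rfl
    apply hx
    rcases Sym2.mem_iff.1 hw with rfl | rfl <;> simp
  have hxe : ∀ f ∈ E, ∀ w ∈ f, w ∈ s(u, v) → c f ≠ x := by
    rintro f hf w hw hw' rfl
    apply hx
    refine mem_union_left _ (mem_image_of_mem c ?_)
    rcases Sym2.mem_iff.1 hw' with rfl | rfl
    · exact mem_union_left _ (mem_filter.2 ⟨hf, hw⟩)
    · exact mem_union_right _ (mem_filter.2 ⟨hf, hw⟩)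
  have hMFE : M ∪ F = insert s(u, v) E := by
    rw [hE, ← union_insert, insert_erase he]
  rw [hMFE]
  refine ⟨Function.update c s(u, v) x, fun f hf => ?_, fun f hf g hg hfg w hwf hwg => ?_,
    fun f hf w hw => ?_⟩
  · rw [Function.update_of_ne (ne_of_mem_of_not_mem hf heM), hc₀ f hf]
  · rcases mem_insert.1 hf with rfl | hf'
    · rcases mem_insert.1 hg with rfl | hg'
      · exact absurd rfl hfg
      · rw [Function.update_self, Function.update_of_ne hfg.symm]
        exact (hxe g hg' w hwg hwf).symm
    · have hfne : f ≠ s(u, v) := fun h => heE (h ▸ hf')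
      rcases mem_insert.1 hg with rfl | hg'
      · rw [Function.update_self, Function.update_of_ne hfg]
        exact hxe f hf' w hwf hwg
      · rw [Function.update_of_ne hfne, Function.update_of_ne (ne_of_mem_of_not_mem hg' heE)]
        exact hcc f hf' g hg' hfg w hwf hwg
  · rcases mem_insert.1 hf with rfl | hf'
    · rw [Function.update_self]
      exact hxv w hw
    · rw [Function.update_of_ne (ne_of_mem_of_not_mem hf' heE)]
      exact hcv f hf' w hw

end SimpleGraph

/-! ### Assembling the total coloring -/

theorem mainTheorem6 {V : Type*} [Fintype V] (G : SimpleGraph V) [DecidableRel G.Adj]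
    (hG : G.IsPlanar) (H : G.Subgraph) (hH : H.IsMatching)
    (φ : H.coe.TotalColoring (G.maxDegree + 7)) (hφ : φ.IsIn) :
    ∃ ψ : G.TotalColoring (G.maxDegree + 7), ψ.Extends φ := by
  classical
  obtain ⟨vc, hvc, hvcφ⟩ := G.exists_vertexColoring_extending (k := G.maxDegree + 7) (by lia)
    H.verts (fun v => if h : v ∈ H.verts then φ.vert ⟨v, h⟩ else 0) (by
      intro u hu v hv huv
      simp only [hu, hv, dif_pos]
      exact hφ ⟨u, hu⟩ ⟨v, hv⟩ huv)
  have hvc' : ∀ v : H.verts, vc v = φ.vert v := fun v => by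
    rw [hvcφ v v.2, dif_pos v.2]
  let M : Finset (Sym2 V) := {e ∈ G.edgeFinset | e ∈ H.edgeSet}
  have hMmem : ∀ e, e ∈ M ↔ e ∈ H.edgeSet := fun e => by
    simp only [M, Finset.mem_filter, SimpleGraph.mem_edgeFinset, and_iff_right_iff_imp]
    exact fun h => H.edgeSet_subset h
  have hlift : ∀ e ∈ M, ∃ f : H.coe.edgeSet, (H.hom.mapEdgeSet f).1 = e := by
    intro e he
    rw [hMmem] at he
    induction e with | _ a b
    exact ⟨⟨s(⟨a, H.edge_vert he⟩, ⟨b, H.edge_vert he.symm⟩), he⟩, rfl⟩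
  have hinj : ∀ f g : H.coe.edgeSet, (H.hom.mapEdgeSet f).1 = (H.hom.mapEdgeSet g).1 → f = g :=
    fun f g h => SimpleGraph.Hom.mapEdgeSet.injective _ Subtype.val_injective (Subtype.ext h)
  -- Transport `φ.edge` to pairs in `V`; the value 0 away from `H` is never used.
  let c₀ : Sym2 V → Fin (G.maxDegree + 7) := fun e =>
    if h : ∃ f : H.coe.edgeSet, (H.hom.mapEdgeSet f).1 = e then φ.edge h.choose else 0
  have hc₀ : ∀ f : H.coe.edgeSet, c₀ (H.hom.mapEdgeSet f).1 = φ.edge f := by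
    intro f
    have h : ∃ g : H.coe.edgeSet, (H.hom.mapEdgeSet g).1 = (H.hom.mapEdgeSet f).1 := ⟨f, rfl⟩
    simp only [c₀, dif_pos h]
    rw [hinj _ _ h.choose_spec]
  obtain ⟨ec, hec₀, hecc, hecv⟩ := hG.exists_edgeColoring_extending M
    (fun e he => H.edgeSet_subset ((hMmem e).1 he))
    (fun v => Finset.card_le_one.2 fun e he f hf => by
      rw [Finset.mem_filter, hMmem] at he hf
      obtain ⟨he, a, rfl⟩ := he
      obtain ⟨hf, b, rfl⟩ := hf
      exact congrArg _ ((hH (H.edge_vert he)).unique he hf))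
    vc c₀ (fun e he v hv => by
      obtain ⟨f, rfl⟩ := hlift e he
      obtain ⟨w, hw, rfl⟩ := Sym2.mem_map.1 hv
      rw [hc₀]
      exact hvc' w ▸ φ.vert_ne_edge w f hw)
    (G.edgeFinset \ M) (fun e he => SimpleGraph.mem_edgeFinset.1 (Finset.mem_sdiff.1 he).1)
    Finset.disjoint_sdiff
  have hall : ∀ e : G.edgeSet, e.1 ∈ M ∪ (G.edgeFinset \ M) := fun e => by
    by_cases h : e.1 ∈ M
    · exact Finset.mem_union_left _ h
    · exact Finset.mem_union_right _
        (Finset.mem_sdiff.2 ⟨SimpleGraph.mem_edgeFinset.2 e.2, h⟩)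
  refine ⟨{
    vert := vc
    edge := fun e => ec e.1
    vert_ne := hvc
    edge_ne := fun e f hef => hecc e.1 (hall e) f.1 (hall f) fun h => hef (Subtype.ext h)
    vert_ne_edge := fun v e hv => hecv e.1 (hall e) v hv }, hvc', fun f => ?_⟩
  change ec (H.hom.mapEdgeSet f).1 = φ.edge f
  rw [← hc₀, hec₀]
  rw [hMmem]
  obtain ⟨f, hf⟩ := f
  induction f with | _ a b
  exact hf
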